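/- **Proposition (Gateaux derivative of $\hat\Psi$).** For $X\in\mathbb{R}^{n_1\times n_2}$ let $m=\min(n_1,n_2)$ and let $\sigma_1(X)\ge\dots\ge\sigma_m(X)\ge 0$ be the singular values of $X$. For $d_1,\dots,d_m\in\mathbb{R}$ let $\mathrm{Diag}(d_1,\dots,d_m)_{n_1\times n_2}$ be the $n_1\times n_2$ matrix with diagonal entries $d_1,\dots,d_m$ and all other entries $0$. For $\varphi:\mathbb{R}\to\mathbb{R}$ and $\alpha\in\mathbb{R}$ put $$\psi(t)=\varphi(t)-\alpha|t|,\qquad \hat\Psi(X)=\sum_{i=1}^{m}\psi(\sigma_i(X)).$$ (a) Suppose that $\varphi$ is even and $\psi$ is $C^1$ on $\mathbb{R}$. Then $\hat\Psi$ is Gateaux differentiable at every $X\in\mathbb{R}^{n_1\times n_2}$, and, identifying the derivative with the matrix representing it in the Frobenius inner product $\langle G,H\rangle=\mathrm{tr}(G^{*}H)$, $$D_X\hat\Psi(X)=U^{*}\Lambda V,\qquad \Lambda=\mathrm{Diag}\big(\psi'(\sigma_1(X)),\dots,\psi'(\sigma_m(X))\big)_{n_1\times n_2},$$ for every singular value decomposition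 $X=U^{*}\Sigma V$ with $U\in\mathbb{R}^{n_1\times n_1}$, $V\in\mathbb{R}^{n_2\times n_2}$ orthogonal and $\Sigma=\mathrm{Diag}(\sigma_1(X),\dots,\sigma_m(X))_{n_1\times n_2}$ (so the rows of $U$ and $V$ are left and right singular vectors of $X$). That is, $\lim_{t\to0}\frac{\hat\Psi(X+tH)-\hat\Psi(X)}{t}=\langle U^{*}\Lambda V,H\rangle$ for every $H\in\mathbb{R}^{n_1\times n_2}$. (b) In particular, for $\alpha>0$ and $\varphi(t)=\frac{\alpha|t|}{1+\alpha|t|}$, the function $\psi$ is $C^2$ on $\mathbb{R}$, $\hat\Psi$ is Gateaux differentiable at every $X\in\mathbb{R}^{n_1\times n_2}$, and the same formula $D_X\hat\Psi(X)=U^{*}\Lambda V$ holds for every such singular value decomposition. -/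

import Mathlib

/-- The `i`-th largest singular value (counted from `0`) of the real matrix `X`. -/
noncomputable def sigma {m n : ℕ} (X : Matrix (Fin m) (Fin n) ℝ) (i : ℕ) : ℝ :=
  (Matrix.toEuclideanLin X).singularValues i

/-- The `m × n` rectangular diagonal matrix with diagonal entries `d 0, d 1, …`. -/
def rectDiag (m n : ℕ) (d : ℕ → ℝ) : Matrix (Fin m) (Fin n) ℝ :=
  Matrix.of fun i j => if (i : ℕ) = (j : ℕ) then d i else 0

/-- `X = Uᵀ Σ V` is a (full) singular value decomposition of `X`: the rows of the orthogonal
matrices `U` and `V` are left and right singular vectors of `X`, in the order of the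
decreasing singular values. -/
structure IsSVD {m n : ℕ} (X : Matrix (Fin m) (Fin n) ℝ)
    (U : Matrix (Fin m) (Fin m) ℝ) (V : Matrix (Fin n) (Fin n) ℝ) : Prop where
  left_orthogonal : U ∈ Matrix.orthogonalGroup (Fin m) ℝ
  right_orthogonal : V ∈ Matrix.orthogonalGroup (Fin n) ℝ
  eq_mul : X = U.transpose * rectDiag m n (sigma X) * V

/-- The penalty `φ(t) = α|t| / (1 + α|t|)`. -/
noncomputable def fracPenalty (α t : ℝ) : ℝ := α * |t| / (1 + α * |t|)

/-- `ψ(t) = φ(t) - α|t|`. -/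
def psi (φ : ℝ → ℝ) (α t : ℝ) : ℝ := φ t - α * |t|

/-- `Φ̂(X) = ∑ φ(σ_i(X))`, the sum over the `min m n` singular values of `X`. -/
noncomputable def PhiHat {m n : ℕ} (φ : ℝ → ℝ) (X : Matrix (Fin m) (Fin n) ℝ) : ℝ :=
  ∑ i ∈ Finset.range (min m n), φ (sigma X i)

/-- The nuclear norm `‖X‖_*`. -/
noncomputable def nuclearNorm {m n : ℕ} (X : Matrix (Fin m) (Fin n) ℝ) : ℝ :=
  ∑ i ∈ Finset.range (min m n), sigma X i

/-- `Ψ̂(X) = ∑ ψ(σ_i(X))`, the sum over the `min m n` singular values of `X`. -/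
noncomputable def PsiHat {m n : ℕ} (φ : ℝ → ℝ) (α : ℝ) (X : Matrix (Fin m) (Fin n) ℝ) : ℝ :=
  ∑ i ∈ Finset.range (min m n), psi φ α (sigma X i)

/-- `Ψ̂(X) = Φ̂(X) - α‖X‖_*`. -/
theorem PsiHat_eq {m n : ℕ} (φ : ℝ → ℝ) (α : ℝ) (X : Matrix (Fin m) (Fin n) ℝ) :
    PsiHat φ α X = PhiHat φ X - α * nuclearNorm X := by
  have h : ∀ i, |sigma X i| = sigma X i := fun i =>
    abs_of_nonneg ((Matrix.toEuclideanLin X).singularValues_nonneg i)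
  simp [PsiHat, PhiHat, nuclearNorm, psi, h, Finset.sum_sub_distrib, Finset.mul_sum]

/-- `F` is Gateaux differentiable at `X` and its Gateaux derivative is the linear functional
`H ↦ ⟨G, H⟩ = tr(Gᵀ H)`, that is, it is represented by the matrix `G` in the Frobenius inner
product. -/
def HasGateauxDerivAt {m n : ℕ} (F : Matrix (Fin m) (Fin n) ℝ → ℝ)
    (G X : Matrix (Fin m) (Fin n) ℝ) : Prop :=
  ∀ H : Matrix (Fin m) (Fin n) ℝ,
    HasLineDerivAt ℝ F (Matrix.trace (G.transpose * H)) X H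

/-! Individual singular values need not be differentiable where they vanish or coincide, so they are
never differentiated. For `f t = t ^ (2k+2)` the sum `∑ f(σ_i)` is `tr((XᵀX)^(k+1))`, whose
derivative along `H` is `(2k+2) tr((XᵀX)^k Xᵀ H)`; in any SVD this is the pairing of `Uᵀ
Diag(f'(σ_i)) V` with `H` (`hasDerivAt_sum_sigma_pow`). Linearity gives all even polynomials. For
even `f` of class C¹, `f'` is odd and is approximated uniformly on a compact interval by odd
polynomials (Weierstrass, then odd part). Their even primitives satisfy the formula along the line,
and values and derivatives converge, the latter uniformly, so the formula passes to the limit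
(`spectralDerivative_of_even`). Uniqueness of the derivative makes the matrix independent of the
SVD. -/

/-! ### Existence of the singular value decomposition -/

/-- Singular values beyond the size of the matrix vanish. -/
theorem sigma_eq_zero_of_min_le {m n : ℕ} (X : Matrix (Fin m) (Fin n) ℝ) {i : ℕ}
    (hi : min m n ≤ i) : sigma X i = 0 := by
  have h1 : Module.finrank ℝ (LinearMap.range (Matrix.toEuclideanLin X)) ≤ m := by
    simpa using Submodule.finrank_le (LinearMap.range (Matrix.toEuclideanLin X))
  have h2 : Module.finrank ℝ (LinearMap.range (Matrix.toEuclideanLin X)) ≤ n := by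
    simpa using LinearMap.finrank_range_le (Matrix.toEuclideanLin X)
  exact (LinearMap.singularValues_eq_zero_iff_le_finrank_range _).mpr (by omega)

theorem sigma_nonneg {m n : ℕ} (X : Matrix (Fin m) (Fin n) ℝ) (i : ℕ) : 0 ≤ sigma X i :=
  (Matrix.toEuclideanLin X).singularValues_nonneg i

/-- The matrix whose rows are the vectors of an orthonormal basis is orthogonal. -/
theorem orthonormalBasis_rows_mem_orthogonalGroup {n : ℕ}
    (b : OrthonormalBasis (Fin n) ℝ (EuclideanSpace ℝ (Fin n))) :
    (Matrix.of fun i k => b i k) ∈ Matrix.orthogonalGroup (Fin n) ℝ := by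
  rw [Matrix.mem_orthogonalGroup_iff]
  ext i j
  have h := orthonormal_iff_ite.mp b.orthonormal j i
  rw [PiLp.inner_apply] at h
  simpa [Matrix.mul_apply, Matrix.one_apply, eq_comm, Matrix.star_eq_conjTranspose] using h

/-- Every real matrix has a singular value decomposition. -/
theorem exists_isSVD {m n : ℕ} (X : Matrix (Fin m) (Fin n) ℝ) : ∃ U V, IsSVD X U V := by
  set T := Matrix.toEuclideanLin X with hT
  have hn : Module.finrank ℝ (EuclideanSpace ℝ (Fin n)) = n := by simp
  set v := T.isSymmetric_adjoint_comp_self.eigenvectorBasis hn with hv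
  have hinner : ∀ i j, inner ℝ (T (v i)) (T (v j)) = if i = j then sigma X j ^ 2 else 0 := by
    intro i j
    rw [← LinearMap.adjoint_inner_right]
    have h1 := T.isSymmetric_adjoint_comp_self.apply_eigenvectorBasis hn j
    rw [← T.sq_singularValues_fin hn j] at h1
    rw [← hv, LinearMap.comp_apply] at h1
    rw [h1, inner_smul_right, orthonormal_iff_ite.mp v.orthonormal]
    simp [sigma, hT]
  have hzero : ∀ j : Fin n, sigma X j = 0 → T (v j) = 0 := by
    intro j hj
    have := hinner j j
    simpa [hj] using this
  -- The left singular vectors `T v_i / σ_i`; the zero vectors outside `s` are discarded and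
  -- replaced by the extension to a basis.
  let w : Fin m → EuclideanSpace ℝ (Fin m) := fun i =>
    if h : (i : ℕ) < n then (sigma X i)⁻¹ • T (v ⟨i, h⟩) else 0
  let s : Set (Fin m) := {i | (i : ℕ) < n ∧ sigma X i ≠ 0}
  have how : Orthonormal ℝ (s.domRestrict w) := by
    rw [orthonormal_iff_ite]
    rintro ⟨i, hi⟩ ⟨j, hj⟩
    have hwi : w i = (sigma X i)⁻¹ • T (v ⟨i, hi.1⟩) := dif_pos hi.1
    have hwj : w j = (sigma X j)⁻¹ • T (v ⟨j, hj.1⟩) := dif_pos hj.1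
    rw [Set.domRestrict_apply, Set.domRestrict_apply, hwi, hwj, inner_smul_left,
      inner_smul_right, hinner]
    simp only [Subtype.mk.injEq, Fin.ext_iff]
    split_ifs with h
    · have hj2 := hj.2
      rw [h]
      simp
      field_simp
    · simp
  obtain ⟨b, hb⟩ := how.exists_orthonormalBasis_extension_of_card_eq (by simp)
  have hTv : ∀ j : Fin n, ∀ k, T (v j) k = ∑ i : Fin m, b i k * rectDiag m n (sigma X) i j := by
    intro j k
    by_cases hj : sigma X j = 0
    · rw [hzero j hj]
      symm
      simp only [PiLp.zero_apply]
      refine Finset.sum_eq_zero fun i _ => ?_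
      by_cases hij : (i : ℕ) = j <;> simp [rectDiag, hij, hj]
    · have hjm : (j : ℕ) < m := by
        by_contra h
        exact hj (sigma_eq_zero_of_min_le X (by omega))
      have hbj : b ⟨j, hjm⟩ = (sigma X j)⁻¹ • T (v j) := by
        rw [hb ⟨j, hjm⟩ ⟨j.2, hj⟩]
        simp [w]
      rw [Finset.sum_eq_single ⟨j, hjm⟩]
      · rw [hbj]
        simp [rectDiag]
        field_simp
      · intro i _ hi
        have : (i : ℕ) ≠ j := fun h => hi (Fin.ext h)
        simp [rectDiag, this]
      · simp
  have hU := orthonormalBasis_rows_mem_orthogonalGroup b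
  have hV := orthonormalBasis_rows_mem_orthogonalGroup v
  refine ⟨_, _, hU, hV, ?_⟩
  have key : X * (Matrix.of fun i k => v i k).transpose
      = (Matrix.of fun i k => b i k).transpose * rectDiag m n (sigma X) := by
    ext k j
    have := hTv j k
    simpa [Matrix.mul_apply, hT, Matrix.toLpLin_apply, Matrix.mulVec, dotProduct] using this
  rw [← key, Matrix.mul_assoc]
  have h2 := (Matrix.mem_orthogonalGroup_iff' (Fin n) ℝ).mp hV
  rw [h2, Matrix.mul_one]

/-! ### Power sums of singular values as traces, and their derivatives -/

section MatrixCalculus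

attribute [local instance] Matrix.linftyOpNormedRing Matrix.linftyOpNormedAlgebra

/-- Cyclicity of the trace makes the `k` terms of the noncommutative Leibniz rule equal. The
hypothesis is entrywise, so the auxiliary matrix norm stays out of the statement. -/
theorem HasDerivAt.trace_pow {n : ℕ} {A : ℝ → Matrix (Fin n) (Fin n) ℝ}
    {A' : Matrix (Fin n) (Fin n) ℝ} {t : ℝ}
    (hA : ∀ i j, HasDerivAt (fun s => A s i j) (A' i j) t) (k : ℕ) :
    HasDerivAt (fun s => (A s ^ k).trace) (k * (A t ^ (k - 1) * A').trace) t := by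
  have hA : HasDerivAt A A' t := by
    refine hasDerivAt_pi.2 fun i => hasDerivAt_pi.2 fun j => hA i j
  have h := hA.fun_pow' k
  have h2 : HasDerivAt (fun s => (A s ^ k).trace) _ t :=
    (LinearMap.toContinuousLinearMap (Matrix.traceLinearMap (Fin n) ℝ ℝ)).hasFDerivAt.comp_hasDerivAt
      t h
  convert h2 using 1
  change _ = (∑ i ∈ Finset.range k, A t ^ (k.pred - i) * A' * A t ^ i).trace
  rw [Matrix.trace_sum]
  rw [Finset.sum_congr rfl (g := fun _ => (A t ^ (k - 1) * A').trace)]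
  · simp
  · intro i hi
    rw [Finset.mem_range] at hi
    rw [Matrix.trace_mul_cycle, ← pow_add]
    congr 3
    rw [Nat.pred_eq_sub_one]
    omega

end MatrixCalculus

theorem IsSVD.left_mul_transpose {m n : ℕ} {X : Matrix (Fin m) (Fin n) ℝ} {U V}
    (h : IsSVD X U V) : U * U.transpose = 1 :=
  (Matrix.mem_orthogonalGroup_iff (Fin m) ℝ).mp h.left_orthogonal

theorem IsSVD.right_mul_transpose {m n : ℕ} {X : Matrix (Fin m) (Fin n) ℝ} {U V}
    (h : IsSVD X U V) : V * V.transpose = 1 :=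
  (Matrix.mem_orthogonalGroup_iff (Fin n) ℝ).mp h.right_orthogonal

theorem IsSVD.right_transpose_mul {m n : ℕ} {X : Matrix (Fin m) (Fin n) ℝ} {U V}
    (h : IsSVD X U V) : V.transpose * V = 1 :=
  (Matrix.mem_orthogonalGroup_iff' (Fin n) ℝ).mp h.right_orthogonal

/-- For `m < n` the columns from `m` on are zero, which is why `d` must vanish there. -/
theorem rectDiag_transpose_mul_self {m n : ℕ} {d : ℕ → ℝ} (hd : ∀ i, m ≤ i → d i = 0) :
    (rectDiag m n d).transpose * rectDiag m n d = Matrix.diagonal fun j : Fin n => d j ^ 2 := by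
  ext i j
  simp only [Matrix.mul_apply, Matrix.transpose_apply, rectDiag, Matrix.of_apply,
    Matrix.diagonal_apply]
  by_cases him : (i : ℕ) < m
  · rw [Finset.sum_eq_single ⟨i, him⟩]
    · by_cases hij : i = j
      · simp [hij, sq]
      · have : (i : ℕ) ≠ j := fun h => hij (Fin.ext h)
        simp [hij, this]
    · intro k _ hk
      have : (k : ℕ) ≠ i := fun h => hk (Fin.ext h)
      simp [this]
    · simp
  · rw [Finset.sum_eq_zero]
    · simp [hd i (by omega)]
    · intro k _
      have : (k : ℕ) ≠ i := by omega
      simp [this]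

theorem IsSVD.gram_pow {m n : ℕ} {X : Matrix (Fin m) (Fin n) ℝ} {U V}
    (h : IsSVD X U V) (k : ℕ) :
    (X.transpose * X) ^ k =
      V.transpose * Matrix.diagonal (fun j : Fin n => (sigma X j ^ 2) ^ k) * V := by
  have hX : X.transpose * X
      = V.transpose * Matrix.diagonal (fun j : Fin n => sigma X j ^ 2) * V := by
    rw [← rectDiag_transpose_mul_self (m := m) (d := sigma X)
      fun i hi => sigma_eq_zero_of_min_le X (by omega)]
    calc X.transpose * X
        = (U.transpose * rectDiag m n (sigma X) * V).transpose *
          (U.transpose * rectDiag m n (sigma X) * V) := by rw [← h.eq_mul]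
      _ = V.transpose * (rectDiag m n (sigma X)).transpose * (U * U.transpose) *
          rectDiag m n (sigma X) * V := by
          simp only [Matrix.transpose_mul, Matrix.transpose_transpose, Matrix.mul_assoc]
      _ = _ := by rw [h.left_mul_transpose]; simp only [Matrix.mul_assoc, Matrix.one_mul]
  induction k with
  | zero =>
    have : (Matrix.diagonal fun _ : Fin n => (1 : ℝ)) = 1 := Matrix.diagonal_one
    simp [this, h.right_transpose_mul]
  | succ k ih =>
    rw [pow_succ, ih, hX]
    simp_rw [pow_succ _ k, ← Matrix.diagonal_mul_diagonal]
    calc _ = V.transpose * Matrix.diagonal (fun j : Fin n => (sigma X j ^ 2) ^ k) *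
          (V * V.transpose) * Matrix.diagonal (fun j : Fin n => sigma X j ^ 2) * V := by
          simp only [Matrix.mul_assoc]
      _ = _ := by rw [h.right_mul_transpose]; simp only [Matrix.mul_assoc, Matrix.one_mul]

/-- Even power sums of singular values are traces of powers of the Gram matrix. -/
theorem sum_sigma_pow_eq_trace {m n : ℕ} (X : Matrix (Fin m) (Fin n) ℝ) {k : ℕ} (hk : k ≠ 0) :
    ∑ i ∈ Finset.range (min m n), sigma X i ^ (2 * k) = ((X.transpose * X) ^ k).trace := by
  obtain ⟨U, V, h⟩ := exists_isSVD X
  rw [h.gram_pow, Matrix.trace_mul_cycle, h.right_mul_transpose, Matrix.one_mul,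
    Matrix.trace_diagonal, Fin.sum_univ_eq_sum_range (fun j => (sigma X j ^ 2) ^ k)]
  simp_rw [pow_mul]
  -- The trace has `n` terms; those beyond `min m n` are powers of zero and vanish because `k ≠ 0`.
  refine Finset.sum_subset (by simp) fun i _ hi => ?_
  rw [sigma_eq_zero_of_min_le X (by simpa only [Finset.mem_range, not_lt] using hi)]
  simp [hk]

/-- Links the trace derivative, a polynomial expression in `X` and `Xᵀ`, to the spectral form `Uᵀ Λ
V`. -/
theorem IsSVD.gradient_pow_transpose {m n : ℕ} {X : Matrix (Fin m) (Fin n) ℝ} {U V}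
    (h : IsSVD X U V) (k : ℕ) :
    (U.transpose * rectDiag m n (fun i => sigma X i ^ (2 * k + 1)) * V).transpose =
      (X.transpose * X) ^ k * X.transpose := by
  have hd : Matrix.diagonal (fun j : Fin n => (sigma X j ^ 2) ^ k) *
      (rectDiag m n (sigma X)).transpose =
      (rectDiag m n (fun i => sigma X i ^ (2 * k + 1))).transpose := by
    ext i j
    by_cases hij : (j : ℕ) = i <;> simp [rectDiag, hij, pow_succ, pow_mul]
  have hX : X.transpose = V.transpose * (rectDiag m n (sigma X)).transpose * U := by
    conv_lhs => rw [h.eq_mul]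
    simp only [Matrix.transpose_mul, Matrix.transpose_transpose, Matrix.mul_assoc]
  rw [h.gram_pow, hX]
  calc _ = V.transpose * (Matrix.diagonal (fun j : Fin n => (sigma X j ^ 2) ^ k) *
      (rectDiag m n (sigma X)).transpose) * U := by
        rw [hd]
        simp only [Matrix.transpose_mul, Matrix.transpose_transpose, Matrix.mul_assoc]
    _ = V.transpose * Matrix.diagonal (fun j : Fin n => (sigma X j ^ 2) ^ k) *
      (V * V.transpose) * (rectDiag m n (sigma X)).transpose * U := by
        rw [h.right_mul_transpose]; simp only [Matrix.mul_assoc, Matrix.one_mul]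
    _ = _ := by simp only [Matrix.mul_assoc]

/-- The derivative of an even power sum of singular values along a line. -/
theorem hasDerivAt_sum_sigma_pow {m n : ℕ} (X H : Matrix (Fin m) (Fin n) ℝ) (t : ℝ) {U V}
    (h : IsSVD (X + t • H) U V) (k : ℕ) :
    HasDerivAt
      (fun s : ℝ => ∑ i ∈ Finset.range (min m n), sigma (X + s • H) i ^ (2 * (k + 1)))
      ((2 * (k + 1)) * ((U.transpose * rectDiag m n (fun i => sigma (X + t • H) i ^ (2 * k + 1))
        * V).transpose * H).trace) t := by
  simp_rw [sum_sigma_pow_eq_trace _ (Nat.succ_ne_zero k)]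
  have hY : ∀ i j, HasDerivAt (fun s : ℝ => (X + s • H) i j) (H i j) t := by
    intro i j
    simpa using ((hasDerivAt_id t).mul_const (H i j)).const_add (X i j)
  have hA : ∀ i j, HasDerivAt (fun s : ℝ => ((X + s • H).transpose * (X + s • H)) i j)
      ((H.transpose * (X + t • H) + (X + t • H).transpose * H) i j) t := by
    intro i j
    have h := HasDerivAt.fun_sum (u := Finset.univ) fun l _ => (hY l i).mul (hY l j)
    rw [Finset.sum_add_distrib] at h
    exact h
  convert HasDerivAt.trace_pow hA (k + 1) using 1
  rw [h.gradient_pow_transpose]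
  generalize X + t • H = Y
  have h1 : ((Y.transpose * Y) ^ k * (H.transpose * Y)).trace
      = ((Y.transpose * Y) ^ k * Y.transpose * H).trace := by
    rw [← Matrix.trace_transpose]
    simp only [Matrix.transpose_mul, Matrix.transpose_transpose, Matrix.transpose_pow]
    rw [Matrix.trace_mul_comm, Matrix.mul_assoc]
  rw [Nat.add_sub_cancel, Matrix.mul_add, Matrix.trace_add, h1, ← Matrix.mul_assoc]
  push_cast
  ring

/-! ### Bounds uniform along the line -/

/-- The Frobenius pairing with `Uᵀ Diag(d) V`, written out on the diagonal. -/
theorem trace_transpose_mul_rectDiag {m n : ℕ} (U : Matrix (Fin m) (Fin m) ℝ)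
    (V : Matrix (Fin n) (Fin n) ℝ) (H : Matrix (Fin m) (Fin n) ℝ) (d : ℕ → ℝ) :
    ((U.transpose * rectDiag m n d * V).transpose * H).trace =
      ∑ i : Fin m, ∑ j : Fin n,
        if (i : ℕ) = j then d i * (U * H * V.transpose) i j else 0 := by
  have h1 : ((U.transpose * rectDiag m n d * V).transpose * H).trace
      = ((rectDiag m n d).transpose * (U * H * V.transpose)).trace := by
    simp only [Matrix.transpose_mul, Matrix.transpose_transpose, Matrix.mul_assoc]
    rw [Matrix.trace_mul_comm]
    simp only [Matrix.mul_assoc]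
  rw [h1, Matrix.trace, Finset.sum_comm]
  refine Finset.sum_congr rfl fun j _ => ?_
  rw [Matrix.diag_apply, Matrix.mul_apply]
  refine Finset.sum_congr rfl fun i _ => ?_
  simp [rectDiag]

/-- Entries of orthogonal matrices are at most 1 in absolute value. The bound ignores `U` and `V`,
so they need not depend continuously on the point. -/
theorem abs_orthogonal_conj_apply_le {m n : ℕ} {U : Matrix (Fin m) (Fin m) ℝ}
    {V : Matrix (Fin n) (Fin n) ℝ} (hU : U ∈ Matrix.orthogonalGroup (Fin m) ℝ)
    (hV : V ∈ Matrix.orthogonalGroup (Fin n) ℝ) (H : Matrix (Fin m) (Fin n) ℝ)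
    (i : Fin m) (j : Fin n) :
    |(U * H * V.transpose) i j| ≤ ∑ l, ∑ k, |H k l| := by
  rw [Matrix.mul_apply]
  refine (Finset.abs_sum_le_sum_abs _ _).trans (Finset.sum_le_sum fun l _ => ?_)
  have hv : |V.transpose l j| ≤ 1 := entry_norm_bound_of_unitary hV j l
  rw [abs_mul]
  refine (mul_le_of_le_one_right (abs_nonneg _) hv).trans ?_
  rw [Matrix.mul_apply]
  refine (Finset.abs_sum_le_sum_abs _ _).trans (Finset.sum_le_sum fun k _ => ?_)
  rw [abs_mul]
  exact mul_le_of_le_one_left (abs_nonneg _) (entry_norm_bound_of_unitary hU i k)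

/-- Singular values are bounded by the entrywise `ℓ¹` norm. -/
theorem sigma_le_sum_abs {m n : ℕ} (X : Matrix (Fin m) (Fin n) ℝ) (i : ℕ) :
    sigma X i ≤ ∑ l, ∑ k, |X k l| := by
  by_cases hi : i < min m n
  · obtain ⟨U, V, h⟩ := exists_isSVD X
    have hD : U * X * V.transpose = rectDiag m n (sigma X) := by
      calc U * X * V.transpose
          = U * (U.transpose * rectDiag m n (sigma X) * V) * V.transpose := by rw [← h.eq_mul]
        _ = (U * U.transpose) * rectDiag m n (sigma X) * (V * V.transpose) := by
          simp only [Matrix.mul_assoc]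
        _ = _ := by rw [h.left_mul_transpose, h.right_mul_transpose, Matrix.one_mul,
          Matrix.mul_one]
    have hb := abs_orthogonal_conj_apply_le h.left_orthogonal h.right_orthogonal X
      ⟨i, by omega⟩ ⟨i, by omega⟩
    rw [hD] at hb
    refine (le_abs_self _).trans ?_
    simpa [rectDiag] using hb
  · rw [sigma_eq_zero_of_min_le X (by omega)]
    positivity

theorem sigma_add_smul_le {m n : ℕ} (X H : Matrix (Fin m) (Fin n) ℝ) {t : ℝ} (ht : |t| ≤ 1)
    (i : ℕ) : sigma (X + t • H) i ≤ ∑ l, ∑ k, (|X k l| + |H k l|) := by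
  refine (sigma_le_sum_abs _ i).trans (Finset.sum_le_sum fun l _ => Finset.sum_le_sum fun k _ => ?_)
  rw [Matrix.add_apply, Matrix.smul_apply, smul_eq_mul]
  refine (abs_add_le _ _).trans (add_le_add_right ?_ _)
  rw [abs_mul]
  exact mul_le_of_le_one_left (abs_nonneg _) ht

/-! ### The formula for even polynomials -/

/-- `∑ f(σ_i)` is differentiable along every line, with derivative given at each point by the
pairing with `Uᵀ Diag(f'(σ_i)) V` for every singular value decomposition. -/
def SpectralDerivative (f f' : ℝ → ℝ) : Prop :=
  ∀ (m n : ℕ) (X H : Matrix (Fin m) (Fin n) ℝ) (t : ℝ) (U : Matrix (Fin m) (Fin m) ℝ)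
    (V : Matrix (Fin n) (Fin n) ℝ), IsSVD (X + t • H) U V →
    HasDerivAt (fun s : ℝ => ∑ i ∈ Finset.range (min m n), f (sigma (X + s • H) i))
      ((U.transpose * rectDiag m n (fun i => f' (sigma (X + t • H) i)) * V).transpose * H).trace t

theorem SpectralDerivative.add {f f' g g' : ℝ → ℝ} (hf : SpectralDerivative f f')
    (hg : SpectralDerivative g g') :
    SpectralDerivative (fun t => f t + g t) (fun t => f' t + g' t) := by
  intro m n X H t U V h
  simp only [Finset.sum_add_distrib]
  refine ((hf m n X H t U V h).fun_add (hg m n X H t U V h)).congr_deriv ?_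
  simp only [trace_transpose_mul_rectDiag, ← Finset.sum_add_distrib]
  refine Finset.sum_congr rfl fun i _ => Finset.sum_congr rfl fun j _ => ?_
  split_ifs <;> ring

theorem SpectralDerivative.const_mul {f f' : ℝ → ℝ} (hf : SpectralDerivative f f') (c : ℝ) :
    SpectralDerivative (fun t => c * f t) (fun t => c * f' t) := by
  intro m n X H t U V h
  simp only [← Finset.mul_sum]
  refine ((hf m n X H t U V h).const_mul c).congr_deriv ?_
  simp only [trace_transpose_mul_rectDiag, Finset.mul_sum]
  refine Finset.sum_congr rfl fun i _ => Finset.sum_congr rfl fun j _ => ?_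
  split_ifs <;> ring

theorem SpectralDerivative.const (c : ℝ) : SpectralDerivative (fun _ => c) (fun _ => 0) := by
  intro m n X H t U V h
  refine (hasDerivAt_const t _).congr_deriv ?_
  rw [trace_transpose_mul_rectDiag]
  simp

theorem SpectralDerivative.pow (k : ℕ) :
    SpectralDerivative (fun t => t ^ (2 * (k + 1)) / (2 * (k + 1))) (fun t => t ^ (2 * k + 1)) := by
  intro m n X H t U V h
  have h1 := (hasDerivAt_sum_sigma_pow X H t h k).div_const (2 * ((k : ℝ) + 1))
  simp only [← Finset.sum_div]
  refine h1.congr_deriv ?_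
  field_simp

/-- The odd part of a polynomial has an even primitive for which the spectral derivative
formula holds. -/
theorem exists_spectralDerivative_oddPart (r : Polynomial ℝ) : ∃ f : ℝ → ℝ, f 0 = 0 ∧
    (∀ t, HasDerivAt f ((r.eval t - r.eval (-t)) / 2) t) ∧
    SpectralDerivative f (fun t => (r.eval t - r.eval (-t)) / 2) := by
  induction r using Polynomial.induction_on' with
  | add p q hp hq =>
    obtain ⟨f, f0, fd, fs⟩ := hp
    obtain ⟨g, g0, gd, gs⟩ := hq
    have he : ∀ t, ((p + q).eval t - (p + q).eval (-t)) / 2 =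
        (p.eval t - p.eval (-t)) / 2 + (q.eval t - q.eval (-t)) / 2 := by
      intro t
      simp only [Polynomial.eval_add]
      ring
    simp only [he]
    exact ⟨fun t => f t + g t, by simp [f0, g0], fun t => (fd t).add (gd t), fs.add gs⟩
  | monomial k a =>
    simp only [Polynomial.eval_monomial]
    rcases Nat.even_or_odd' k with ⟨l, rfl | rfl⟩
    · simp only [pow_mul, neg_sq, sub_self, zero_div]
      exact ⟨fun _ => 0, rfl, fun t => hasDerivAt_const t 0, SpectralDerivative.const 0⟩
    · have he : ∀ t : ℝ, (a * t ^ (2 * l + 1) - a * (-t) ^ (2 * l + 1)) / 2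
          = a * t ^ (2 * l + 1) := by
        intro t
        rw [Odd.neg_pow ⟨l, rfl⟩]
        ring
      simp only [he]
      refine ⟨_, ?_, fun t => ?_, (SpectralDerivative.pow l).const_mul a⟩
      · simp
      · refine (((hasDerivAt_pow (2 * (l + 1)) t).div_const (2 * ((l : ℝ) + 1))).const_mul
          a).congr_deriv ?_
        rw [show 2 * (l + 1) - 1 = 2 * l + 1 by omega]
        push_cast
        field_simp

/-! ### From polynomials to C¹ functions -/

/-- The spectral derivative formula for an even continuously differentiable function. -/
theorem spectralDerivative_of_even {f : ℝ → ℝ} (hf : ContDiff ℝ 1 f) (he : Function.Even f)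
    {m n : ℕ} (X H : Matrix (Fin m) (Fin n) ℝ) {U V} (h : IsSVD X U V) :
    HasDerivAt (fun s : ℝ => ∑ i ∈ Finset.range (min m n), f (sigma (X + s • H) i))
      ((U.transpose * rectDiag m n (fun i => deriv f (sigma X i)) * V).transpose * H).trace 0 := by
  obtain ⟨hdiff, hcont⟩ := contDiff_one_iff_deriv.mp hf
  have hodd : ∀ t, deriv f (-t) = -deriv f t := by
    intro t
    have h1 : (fun s => f (-s)) = f := funext he
    have h2 := deriv_comp_neg f t
    rw [h1] at h2
    linarith
  set R : ℝ := ∑ l, ∑ k, (|X k l| + |H k l|) with hR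
  have hR0 : 0 ≤ R := by positivity
  have happrox : ∀ ε : ℝ, 0 < ε → ∃ g g' : ℝ → ℝ, g 0 = 0 ∧ (∀ t, HasDerivAt g (g' t) t) ∧
      SpectralDerivative g g' ∧ ∀ t ∈ Set.Icc (-R) R, |g' t - deriv f t| ≤ ε := by
    intro ε hε
    obtain ⟨r, hr⟩ := exists_polynomial_near_of_continuousOn (-R) R (deriv f) hcont.continuousOn
      ε hε
    obtain ⟨g, g0, gd, gs⟩ := exists_spectralDerivative_oddPart r
    refine ⟨g, _, g0, gd, gs, fun t ht => ?_⟩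
    have h1 := abs_lt.mp (hr t ht)
    -- Since `deriv f` is odd, the odd part of `r` averages the errors at `t` and `-t`, hence stays
    -- within `ε`.
    have h2 := abs_lt.mp (hr (-t) ⟨by linarith [ht.2], by linarith [ht.1]⟩)
    rw [hodd] at h2
    rw [abs_le]
    constructor <;> linarith
  choose! g g' g0 gd gs gε using happrox
  -- An SVD is chosen at every point of the line, with the given one at `t = 0`.
  have hSVD : ∀ t : ℝ, ∃ U' V', IsSVD (X + t • H) U' V' ∧ (t = 0 → U' = U ∧ V' = V) := by
    intro t
    by_cases ht : t = 0
    · exact ⟨U, V, by simpa [ht] using h, fun _ => ⟨rfl, rfl⟩⟩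
    · obtain ⟨U', V', h'⟩ := exists_isSVD (X + t • H)
      exact ⟨U', V', h', fun h0 => absurd h0 ht⟩
  choose Us Vs hs hs0 using hSVD
  have hlim : Filter.Tendsto (fun k : ℕ => 1 / ((k : ℝ) + 1)) Filter.atTop (nhds 0) :=
    tendsto_one_div_add_atTop_nhds_zero_nat
  have hpos : ∀ k : ℕ, 0 < 1 / ((k : ℝ) + 1) := fun k => by positivity
  have hmem : ∀ t ∈ Set.Ioo (-1 : ℝ) 1, ∀ i, sigma (X + t • H) i ∈ Set.Icc 0 R := fun t ht i =>
    ⟨sigma_nonneg _ _, sigma_add_smul_le X H (abs_le.mpr ⟨ht.1.le, ht.2.le⟩) i⟩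
  set C : ℝ := ∑ l, ∑ k, |H k l| with hC
  have hC0 : 0 ≤ C := by positivity
  -- The primitives vanish at 0, so adding `f 0` makes them agree with `f` there; the matching `+ 0`
  -- is the derivative of that constant.
  have main := hasDerivAt_of_tendstoUniformlyOn (l := Filter.atTop) (s := Set.Ioo (-1 : ℝ) 1)
    (x := 0) isOpen_Ioo
    (f := fun (k : ℕ) (t : ℝ) => ∑ i ∈ Finset.range (min m n),
      (g (1 / ((k : ℝ) + 1)) (sigma (X + t • H) i) + f 0))
    (g := fun s : ℝ => ∑ i ∈ Finset.range (min m n), f (sigma (X + s • H) i))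
    (f' := fun (k : ℕ) (t : ℝ) => (((Us t).transpose *
      rectDiag m n (fun i => g' (1 / ((k : ℝ) + 1)) (sigma (X + t • H) i) + 0) *
      Vs t).transpose * H).trace)
    (g' := fun t : ℝ => (((Us t).transpose *
      rectDiag m n (fun i => deriv f (sigma (X + t • H) i)) * Vs t).transpose * H).trace)
    ?_ ?_ ?_ (by simp)
  · simpa [(hs0 0 rfl).1, (hs0 0 rfl).2] using main
  · rw [Metric.tendstoUniformlyOn_iff]
    intro ε hε
    have hl : Filter.Tendsto (fun k : ℕ => (m * n * C) * (1 / ((k : ℝ) + 1))) Filter.atTop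
        (nhds 0) := by simpa using hlim.const_mul (m * n * C)
    filter_upwards [hl.eventually_lt_const hε] with k hk t ht
    refine lt_of_le_of_lt ?_ hk
    rw [dist_comm, Real.dist_eq, trace_transpose_mul_rectDiag, trace_transpose_mul_rectDiag,
      ← Finset.sum_sub_distrib]
    simp only [← Finset.sum_sub_distrib, add_zero]
    have hterm : ∀ (i : Fin m) (j : Fin n),
        |(if (i : ℕ) = j then g' (1 / ((k : ℝ) + 1)) (sigma (X + t • H) i) *
            (Us t * H * (Vs t).transpose) i j else 0) -
          (if (i : ℕ) = j then deriv f (sigma (X + t • H) i) *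
            (Us t * H * (Vs t).transpose) i j else 0)| ≤ 1 / ((k : ℝ) + 1) * C := by
      intro i j
      split_ifs
      · rw [← sub_mul, abs_mul]
        have hi := hmem t ht i
        exact mul_le_mul (gε _ (hpos k) _ ⟨by linarith [hi.1], hi.2⟩)
          (abs_orthogonal_conj_apply_le (hs t).left_orthogonal (hs t).right_orthogonal H i j)
          (abs_nonneg _) (hpos k).le
      · rw [sub_zero, abs_zero]
        exact mul_nonneg (hpos k).le hC0
    calc _ ≤ ∑ i : Fin m, ∑ j : Fin n, 1 / ((k : ℝ) + 1) * C :=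
          (Finset.abs_sum_le_sum_abs _ _).trans (Finset.sum_le_sum fun i _ =>
            (Finset.abs_sum_le_sum_abs _ _).trans (Finset.sum_le_sum fun j _ => hterm i j))
      _ = _ := by
          simp only [Finset.sum_const, Finset.card_univ, Fintype.card_fin, nsmul_eq_mul]
          ring
  · exact Filter.Eventually.of_forall fun k t _ =>
      ((gs _ (hpos k)).add (SpectralDerivative.const (f 0))) m n X H t _ _ (hs t)
  · intro t ht
    refine tendsto_finsetSum _ fun i _ => ?_
    have hi := hmem t ht i
    rw [tendsto_iff_dist_tendsto_zero]
    have hl : Filter.Tendsto (fun k : ℕ => 1 / ((k : ℝ) + 1) * R) Filter.atTop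
        (nhds 0) := by simpa using hlim.mul_const R
    refine squeeze_zero (fun _ => dist_nonneg) (fun k => ?_) hl
    -- Mean value inequality from 0 to `σ_i`: derivatives `ε`-close on `[-R, R]` give values within
    -- `ε R`.
    have hmv := Convex.norm_image_sub_le_of_norm_hasDerivWithin_le (s := Set.Icc (-R) R)
      (f := fun s => g (1 / ((k : ℝ) + 1)) s - f s)
      (f' := fun s => g' (1 / ((k : ℝ) + 1)) s - deriv f s) (C := 1 / ((k : ℝ) + 1))
      (x := 0) (y := sigma (X + t • H) i)
      (fun s _ => ((gd _ (hpos k) s).sub (hdiff s).hasDerivAt).hasDerivWithinAt)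
      (fun s hs => gε _ (hpos k) s hs) (convex_Icc _ _) ⟨by linarith, hR0⟩
      ⟨by linarith [hi.1], hi.2⟩
    rw [g0 _ (hpos k), sub_zero, Real.norm_eq_abs, Real.norm_eq_abs, abs_of_nonneg hi.1] at hmv
    rw [Real.dist_eq]
    calc _ = _ := by congr 1; ring
      _ ≤ _ := hmv
      _ ≤ _ := mul_le_mul_of_nonneg_left hi.2 (hpos k).le

/-! ### Uniqueness and part (a) -/

/-- The matrix representing a Gateaux derivative is unique. -/
theorem HasGateauxDerivAt.unique {m n : ℕ} {F : Matrix (Fin m) (Fin n) ℝ → ℝ}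
    {G G' X : Matrix (Fin m) (Fin n) ℝ} (h : HasGateauxDerivAt F G X)
    (h' : HasGateauxDerivAt F G' X) : G = G' := by
  refine Matrix.transpose_injective (Matrix.ext_iff_trace_mul_right.mpr fun H => ?_)
  exact HasDerivAt.unique (h H) (h' H)

theorem psi_even {φ : ℝ → ℝ} (hφ : Function.Even φ) (α : ℝ) : Function.Even (psi φ α) := by
  intro t
  simp [psi, hφ t]

theorem exists_hasGateauxDerivAt_PsiHat {φ : ℝ → ℝ} {α : ℝ} (hφ : Function.Even φ)
    (hψ : ContDiff ℝ 1 (psi φ α)) {m n : ℕ} (X : Matrix (Fin m) (Fin n) ℝ) :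
    ∃ G : Matrix (Fin m) (Fin n) ℝ, HasGateauxDerivAt (PsiHat φ α) G X ∧
      ∀ (U : Matrix (Fin m) (Fin m) ℝ) (V : Matrix (Fin n) (Fin n) ℝ), IsSVD X U V →
        G = U.transpose * rectDiag m n (fun i => deriv (psi φ α) (sigma X i)) * V := by
  have key : ∀ U V, IsSVD X U V → HasGateauxDerivAt (PsiHat φ α)
      (U.transpose * rectDiag m n (fun i => deriv (psi φ α) (sigma X i)) * V) X :=
    fun U V h H => spectralDerivative_of_even hψ (psi_even hφ α) X H h
  obtain ⟨U, V, h⟩ := exists_isSVD X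
  exact ⟨_, key U V h, fun U' V' h' => (key U V h).unique (key U' V' h')⟩

/-! ### Smoothness of the fractional penalty and part (b) -/

theorem fracPenalty_even (α : ℝ) : Function.Even (fracPenalty α) := by
  intro t
  simp [fracPenalty]

/-- Here `ψ(t) = -α²t² / (1 + α|t|)`: the kinks cancel at 0. The derivative is computed off 0 and
extended through 0 by continuity. -/
theorem hasDerivAt_psi_fracPenalty {α : ℝ} (hα : 0 < α) (t : ℝ) :
    HasDerivAt (psi (fracPenalty α) α)
      (-(α ^ 2 * t * (2 + α * |t|)) / (1 + α * |t|) ^ 2) t := by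
  have hne : ∀ s : ℝ, 1 + α * |s| ≠ 0 := fun s => by positivity
  refine hasDerivAt_of_hasDerivAt_of_ne' (x := 0)
    (g := fun t => -(α ^ 2 * t * (2 + α * |t|)) / (1 + α * |t|) ^ 2) (fun y hy => ?_) ?_ ?_ t
  · have habs := (hasDerivAt_abs hy).const_mul α
    have h := (habs.div (habs.const_add 1) (hne y)).sub habs
    refine h.congr_deriv ?_
    have := hne y
    rcases lt_or_gt_of_ne hy with h0 | h0
    · simp only [h0, sign_neg, abs_of_neg, SignType.coe_neg, SignType.coe_one,
        mul_neg, ← sub_eq_add_neg] at this ⊢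
      field_simp
      ring
    · simp only [h0, sign_pos, abs_of_pos, SignType.coe_one] at this ⊢
      field_simp
      ring
  · unfold psi fracPenalty
    exact ((by fun_prop : ContinuousAt (fun t : ℝ => α * |t|) 0).div (by fun_prop) (hne 0)).sub
      (by fun_prop)
  · exact ContinuousAt.div (by fun_prop) (by fun_prop) (pow_ne_zero 2 (hne 0))

theorem hasDerivAt_deriv_psi_fracPenalty {α : ℝ} (hα : 0 < α) (t : ℝ) :
    HasDerivAt (fun t => -(α ^ 2 * t * (2 + α * |t|)) / (1 + α * |t|) ^ 2)
      (-(2 * α ^ 2) / (1 + α * |t|) ^ 3) t := by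
  have hne : ∀ s : ℝ, 1 + α * |s| ≠ 0 := fun s => by positivity
  refine hasDerivAt_of_hasDerivAt_of_ne' (x := 0)
    (g := fun t => -(2 * α ^ 2) / (1 + α * |t|) ^ 3) (fun y hy => ?_) ?_ ?_ t
  · have habs := (hasDerivAt_abs hy).const_mul α
    have h := ((((hasDerivAt_id y).const_mul (α ^ 2)).mul (habs.const_add 2)).neg).div
      ((habs.const_add 1).pow 2) (pow_ne_zero 2 (hne y))
    refine h.congr_deriv ?_
    have := hne y
    rcases lt_or_gt_of_ne hy with h0 | h0
    · simp only [h0, sign_neg, abs_of_neg, id] at this ⊢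
      push_cast
      field_simp
      simp [abs_of_neg h0]
      field_simp
      ring
    · simp only [h0, sign_pos, abs_of_pos, id] at this ⊢
      push_cast
      field_simp
      simp [abs_of_pos h0]
      field_simp
      ring
  · exact ContinuousAt.div (by fun_prop) (by fun_prop) (pow_ne_zero 2 (hne 0))
  · exact ContinuousAt.div (by fun_prop) (by fun_prop) (pow_ne_zero 3 (hne 0))

theorem contDiff_two_psi_fracPenalty {α : ℝ} (hα : 0 < α) :
    ContDiff ℝ 2 (psi (fracPenalty α) α) := by
  have hne : ∀ s : ℝ, 1 + α * |s| ≠ 0 := fun s => by positivity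
  have h1 := funext fun t => (hasDerivAt_psi_fracPenalty hα t).deriv
  have h2 := funext fun t => (hasDerivAt_deriv_psi_fracPenalty hα t).deriv
  rw [show (2 : WithTop ℕ∞) = 1 + 1 by norm_num, contDiff_succ_iff_deriv]
  refine ⟨fun t => (hasDerivAt_psi_fracPenalty hα t).differentiableAt, by simp, ?_⟩
  rw [h1, contDiff_one_iff_deriv]
  refine ⟨fun t => (hasDerivAt_deriv_psi_fracPenalty hα t).differentiableAt, ?_⟩
  rw [h2]
  exact Continuous.div (by fun_prop) (by fun_prop) fun t => pow_ne_zero 3 (hne t)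

theorem mainTheorem9 :
    (∀ (φ : ℝ → ℝ) (α : ℝ), Function.Even φ → ContDiff ℝ 1 (psi φ α) →
      ∀ (m n : ℕ) (X : Matrix (Fin m) (Fin n) ℝ),
        ∃ G : Matrix (Fin m) (Fin n) ℝ, HasGateauxDerivAt (PsiHat φ α) G X ∧
          ∀ (U : Matrix (Fin m) (Fin m) ℝ) (V : Matrix (Fin n) (Fin n) ℝ), IsSVD X U V →
            G = U.transpose * rectDiag m n (fun i => deriv (psi φ α) (sigma X i)) * V) ∧
    (∀ α : ℝ, 0 < α →
      ContDiff ℝ 2 (psi (fracPenalty α) α) ∧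
      ∀ (m n : ℕ) (X : Matrix (Fin m) (Fin n) ℝ),
        ∃ G : Matrix (Fin m) (Fin n) ℝ, HasGateauxDerivAt (PsiHat (fracPenalty α) α) G X ∧
          ∀ (U : Matrix (Fin m) (Fin m) ℝ) (V : Matrix (Fin n) (Fin n) ℝ), IsSVD X U V →
            G = U.transpose *
              rectDiag m n (fun i => deriv (psi (fracPenalty α) α) (sigma X i)) * V) :=
  ⟨fun _ _ hφ hψ _ _ X => exists_hasGateauxDerivAt_PsiHat hφ hψ X, fun α hα =>
    ⟨contDiff_two_psi_fracPenalty hα, fun _ _ X =>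
      exists_hasGateauxDerivAt_PsiHat (fracPenalty_even α)
        ((contDiff_two_psi_fracPenalty hα).of_le (by norm_num)) X⟩⟩
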